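/- Let $n\ge 2$. For a permutation $\pi$ of $\{1,\dots,n\}$, write $\pi$ in standard cycle form (each cycle, including fixed points, starts with its smallest element, and the cycles are arranged in increasing order of their smallest elements), and let $\mathrm{Flatten}(\pi)=w_1w_2\cdots w_n$ be the word obtained by erasing the parentheses. An occurrence of the pattern $12\text{-}3$ in $w_1\cdots w_n$ is a pair of indices $2\le i<j\le n$ with $w_{i-1}<w_i<w_j$; the word avoids $12\text{-}3$ if it has no occurrence. Let $B_m=\sum_k S(m,k)$ be the Bell numbers and $\tilde B_m=\sum_k(-1)^kS(m,k)$ ($m\ge0$) the complementary Bell numbers, where $S(m,k)$ are the Stirling numbers of the second kind, and put $\tilde B_{-1}=-1$. Let $H_n=\sum_{k=1}^n\frac1k$. For $n\ge 3$, the number of permutations $\pi\in\mathcal S_n$ such that $\mathrm{Flatten}(\pi)$ avoids $12\text{-}3$ is $$-2\sum_{i=0}^{n-2}\binom{n-2}{i}(B_i+B_{i+1})\,\tilde B_{n-i-3},$$ while for $n=2$ this number is $2$. For every $n\ge2$, the average number of occurrences of $12\text{-}3$ in $\mathrm{Flatten}(\pi)$ over $\pi\in\mathcal S_n$ is $$\frac{n^3+3n^2-40n+24}{12n}+H_n.$$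 -/

import Mathlib

namespace FlattenedPattern

open Finset

/-- The cycle of `π` through `i`, written as a word starting at `i`:
`i, π i, π (π i), …`, ending just before `i` comes back. -/
noncomputable def cycleWord {n : ℕ} (π : Equiv.Perm (Fin n)) (i : Fin n) : List (Fin n) :=
  List.iterate π i (Function.minimalPeriod π i)

/-- `i` is the smallest element of its cycle. -/
def IsCycleMin {n : ℕ} (π : Equiv.Perm (Fin n)) (i : Fin n) : Prop :=
  ∀ j, π.SameCycle i j → i ≤ j

open Classical in
/-- The standard cycle form: every cycle (fixed points included) is written with its smallest
element first, and the cycles are listed in ascending order of their smallest elements.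
The letters `1, …, n` are represented by `0, …, n - 1`. -/
noncomputable def standardCycleForm {n : ℕ} (π : Equiv.Perm (Fin n)) : List (List (Fin n)) :=
  ((List.finRange n).filter (fun i => IsCycleMin π i)).map (cycleWord π)

/-- The word obtained from the standard cycle form by erasing the parentheses. -/
noncomputable def flatten {n : ℕ} (π : Equiv.Perm (Fin n)) : List (Fin n) :=
  (standardCycleForm π).flatten

/-- The positions `a`, `b = a + 1`, `c > b` form an occurrence of the pattern 12-3 in `w`. -/
def IsOcc {n : ℕ} (w : List (Fin n)) (a b c : Fin w.length) : Prop :=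
  (a : ℕ) + 1 = b ∧ b < c ∧ w.get a < w.get b ∧ w.get b < w.get c

/-- The word `w` avoids 12-3. -/
def Avoids {n : ℕ} (w : List (Fin n)) : Prop :=
  ¬ ∃ a b c : Fin w.length, IsOcc w a b c

open Classical in
/-- The number of occurrences of 12-3 in `w`. -/
noncomputable def occ {n : ℕ} (w : List (Fin n)) : ℕ :=
  #{t : Fin w.length × Fin w.length × Fin w.length | IsOcc w t.1 t.2.1 t.2.2}

open Classical in
/-- The number of permutations of length `n` that avoid 12-3 in the flattened sense. -/
noncomputable def numAvoiding (n : ℕ) : ℕ :=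
  #{π : Equiv.Perm (Fin n) | Avoids (flatten π)}

/-- The average of the number of occurrences of 12-3 in the flattened word over all
permutations of length `n`. -/
noncomputable def avgOcc (n : ℕ) : ℚ :=
  (∑ π : Equiv.Perm (Fin n), (occ (flatten π) : ℚ)) / Fintype.card (Equiv.Perm (Fin n))

/-- The complementary Bell numbers `∑ k, (-1)^k S(n, k)` for `n ≥ 0`, extended by the convention
that the value at `-1` is `-1` (smaller indices are never used). -/
def complBell : ℤ → ℤ
  | Int.ofNat n => ∑ k ∈ range (n + 1), (-1) ^ k * (Nat.stirlingSecond n k : ℤ)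
  | Int.negSucc _ => -1

end FlattenedPattern

namespace FlattenedPattern

open Finset PowerSeries

/-! ### Binomial convolutions and exponential generating functions -/

theorem sum_range_choose_succ_mul {R : Type*} [CommSemiring R] (a : ℕ → R) (n : ℕ) :
    ∑ j ∈ range (n + 2), ((n + 1).choose j : R) * a j =
      ∑ j ∈ range (n + 1), (n.choose j : R) * (a j + a (j + 1)) := by
  have h : ∑ j ∈ range (n + 1), (n.choose (j + 1) : R) * a (j + 1) + a 0 =
      ∑ j ∈ range (n + 1), (n.choose j : R) * a j := by
    have := Finset.sum_range_succ' (fun j => (n.choose j : R) * a j) (n + 1)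
    rw [Finset.sum_range_succ] at this
    simpa using this.symm
  rw [Finset.sum_range_succ']
  simp only [Nat.choose_succ_succ, Nat.cast_add, add_mul, mul_add, Finset.sum_add_distrib]
  simp only [Nat.choose_zero_right, Nat.cast_one, one_mul]
  rw [← h]
  ring

theorem stirlingSecond_succ_succ_eq_sum (n k : ℕ) :
    Nat.stirlingSecond (n + 1) (k + 1) =
      ∑ j ∈ range (n + 1), n.choose j * Nat.stirlingSecond j k := by
  induction n generalizing k with
  | zero => cases k <;> simp [Nat.stirlingSecond_succ_succ]
  | succ n ih =>
    have h := sum_range_choose_succ_mul (fun j => Nat.stirlingSecond j k) n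
    simp only [Nat.cast_id] at h
    rw [h, Nat.stirlingSecond_succ_succ]
    simp only [mul_add, Finset.sum_add_distrib, ← ih]
    cases k with
    | zero => simp
    | succ k =>
      simp only [Nat.stirlingSecond_succ_succ, mul_add, Finset.sum_add_distrib, ← ih]
      simp only [mul_left_comm _ (k + 1), ← Finset.mul_sum, ← ih]
      simp only [Nat.stirlingSecond_succ_succ]
      ring

theorem complBell_natCast (n N : ℕ) (h : n ≤ N) :
    complBell n = ∑ k ∈ range (N + 1), (-1) ^ k * (Nat.stirlingSecond n k : ℤ) := by
  change ∑ k ∈ range (n + 1), (-1) ^ k * (Nat.stirlingSecond n k : ℤ) = _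
  refine Finset.sum_subset (range_subset_range.2 (by omega)) fun k _ hk => ?_
  rw [Nat.stirlingSecond_eq_zero_of_lt (by simpa using hk)]
  simp

theorem complBell_succ (n : ℕ) :
    complBell ((n + 1 : ℕ) : ℤ) = -∑ j ∈ range (n + 1), (n.choose j : ℤ) * complBell j := by
  have h : ∀ j ∈ range (n + 1), (n.choose j : ℤ) * complBell j =
      ∑ k ∈ range (n + 1), (n.choose j : ℤ) * ((-1) ^ k * (Nat.stirlingSecond j k : ℤ)) := by
    intro j hj
    rw [complBell_natCast j n (by simpa [Nat.lt_succ_iff] using hj), Finset.mul_sum]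
  rw [Finset.sum_congr rfl h, Finset.sum_comm, complBell_natCast (n + 1) (n + 1) le_rfl,
    Finset.sum_range_succ', ← Finset.sum_neg_distrib]
  simp only [Nat.stirlingSecond_succ_zero, Nat.cast_zero, mul_zero, add_zero]
  refine Finset.sum_congr rfl fun k _ => ?_
  rw [stirlingSecond_succ_succ_eq_sum]
  push_cast
  rw [Finset.mul_sum, ← Finset.sum_neg_distrib]
  exact Finset.sum_congr rfl fun j _ => by ring

/-- The exponential generating function of a rational sequence. -/
noncomputable def egf (a : ℕ → ℚ) : ℚ⟦X⟧ := PowerSeries.mk fun n => a n / n.factorial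

theorem egf_injective : Function.Injective egf := by
  intro a b h
  funext n
  have := congrArg (coeff n) h
  simpa [egf, div_left_inj' (Nat.cast_ne_zero.2 n.factorial_ne_zero : (n.factorial : ℚ) ≠ 0)]
    using this

theorem derivative_egf (a : ℕ → ℚ) : d⁄dX ℚ (egf a) = egf fun n => a (n + 1) := by
  ext n
  have h : (n.factorial : ℚ) ≠ 0 := Nat.cast_ne_zero.2 n.factorial_ne_zero
  have h' : (n : ℚ) + 1 ≠ 0 := by positivity
  simp only [egf, coeff_derivative, coeff_mk, Nat.factorial_succ, Nat.cast_mul, Nat.cast_add,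
    Nat.cast_one]
  field_simp

theorem egf_mul (a b : ℕ → ℚ) :
    egf a * egf b = egf fun n => ∑ i ∈ range (n + 1), (n.choose i : ℚ) * a i * b (n - i) := by
  ext n
  rw [coeff_mul, Finset.Nat.sum_antidiagonal_eq_sum_range_succ_mk]
  simp only [egf, coeff_mk, Finset.sum_div]
  refine Finset.sum_congr rfl fun i hi => ?_
  have hi' : i ≤ n := by simpa [Nat.lt_succ_iff] using hi
  rw [Nat.cast_choose ℚ hi']
  have h1 : (n.factorial : ℚ) ≠ 0 := Nat.cast_ne_zero.2 n.factorial_ne_zero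
  have h2 : (i.factorial : ℚ) ≠ 0 := Nat.cast_ne_zero.2 i.factorial_ne_zero
  have h3 : ((n - i).factorial : ℚ) ≠ 0 := Nat.cast_ne_zero.2 (n - i).factorial_ne_zero
  field_simp

theorem egf_add (a b : ℕ → ℚ) : egf a + egf b = egf fun n => a n + b n := by
  ext n
  simp [egf, add_div]

theorem egf_smul (c : ℚ) (a : ℕ → ℚ) : C c * egf a = egf fun n => c * a n := by
  ext n
  simp [egf, mul_div_assoc]

theorem egf_one_mul (a : ℕ → ℚ) :
    egf (fun _ => 1) * egf a = egf fun n => ∑ j ∈ range (n + 1), (n.choose j : ℚ) * a j := by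
  rw [mul_comm, egf_mul]
  simp

theorem derivative_egf_bell :
    d⁄dX ℚ (egf fun n => (Nat.bell n : ℚ)) =
      egf (fun _ => 1) * egf fun n => (Nat.bell n : ℚ) := by
  rw [derivative_egf, egf_mul]
  congr 1
  funext n
  rw [Nat.bell_succ, ← Nat.range_succ_eq_Iic]
  push_cast
  simp

theorem derivative_egf_complBell :
    d⁄dX ℚ (egf fun n => (complBell n : ℚ)) =
      -(egf (fun _ => 1) * egf fun n => (complBell n : ℚ)) := by
  have h : ∀ n : ℕ, (complBell ((n + 1 : ℕ) : ℤ) : ℚ) =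
      (-1) * ∑ j ∈ range (n + 1), (n.choose j : ℚ) * (complBell j : ℚ) := by
    intro n
    rw [complBell_succ]
    push_cast
    ring
  rw [derivative_egf, egf_one_mul]
  simp only [h]
  rw [← egf_smul]
  simp

theorem egf_bell_mul_egf_complBell :
    (egf fun n => (Nat.bell n : ℚ)) * (egf fun n => (complBell n : ℚ)) = 1 := by
  apply PowerSeries.derivative.ext
  · rw [Derivation.leibniz, derivative_egf_bell, derivative_egf_complBell, derivative_one]
    simp only [smul_eq_mul]
    ring
  · rw [map_mul]
    simp [egf, ← coeff_zero_eq_constantCoeff_apply]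
    simp [complBell]

/-- The closed form for the number of avoiding permutations of length `m + 2`. -/
def bellConv (m : ℕ) : ℚ :=
  -2 * ∑ i ∈ range (m + 1),
    (m.choose i : ℚ) * ((Nat.bell i : ℚ) + Nat.bell (i + 1)) * complBell (((m - i : ℕ) : ℤ) - 1)

theorem bellConv_zero : bellConv 0 = 4 := by
  have : complBell (-1) = -1 := rfl
  norm_num [bellConv, this]

theorem bellConv_one : bellConv 1 = 2 := by
  have : complBell (-1) = -1 := rfl
  have h0 : complBell 0 = 1 := rfl
  norm_num [bellConv, Finset.sum_range_succ, this, h0]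

theorem bellConv_add_two (m : ℕ) :
    bellConv (m + 2) =
      ∑ j ∈ range (m + 1), (m.choose j : ℚ) * (bellConv (j + 1) + 2 * bellConv j) - 4 := by
  set e := egf (fun _ => 1) with he
  set b := egf fun n => (Nat.bell n : ℚ) with hb
  set c := egf fun n => (complBell n : ℚ) with hc
  set P := egf fun n => (complBell ((n : ℤ) - 1) : ℚ) with hP
  have de : d⁄dX ℚ e = e := derivative_egf _
  have db : d⁄dX ℚ b = e * b := derivative_egf_bell
  have dc : d⁄dX ℚ c = -(e * c) := derivative_egf_complBell
  have dP : d⁄dX ℚ P = c := by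
    rw [hP, derivative_egf]
    simp [hc]
  have bc : b * c = 1 := egf_bell_mul_egf_complBell
  have hH : egf bellConv = -2 * ((b + e * b) * P) := by
    have h2 : (-2 : ℚ⟦X⟧) = C (-2) := by rw [map_neg, map_ofNat]
    rw [← db, hb, derivative_egf, egf_add, hP, egf_mul, h2, egf_smul]
    rfl
  have d2 : d⁄dX ℚ (-2 : ℚ⟦X⟧) = 0 := by
    have h2 : (-2 : ℚ⟦X⟧) = C (-2) := by rw [map_neg, map_ofNat]
    rw [h2, derivative_C]
  have key : d⁄dX ℚ (d⁄dX ℚ (egf bellConv)) =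
      e * (d⁄dX ℚ (egf bellConv) + 2 * egf bellConv) - 4 * e := by
    rw [hH]
    simp only [Derivation.leibniz, map_add, smul_eq_mul, de, db, dc, dP, d2, map_zero]
    linear_combination (-4 * e) * bc
  have h2 : (2 : ℚ⟦X⟧) = C 2 := (map_ofNat C 2).symm
  have h4 : (4 : ℚ⟦X⟧) * e = -(C (-4) * e) := by rw [map_neg, map_ofNat, neg_mul, neg_neg]
  rw [h4, sub_neg_eq_add, derivative_egf, derivative_egf, h2, egf_smul, egf_add, he, egf_one_mul,
    egf_smul, egf_add] at key
  have := congrFun (egf_injective key) m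
  rw [this]
  ring

/-! ### Insertion of a new largest letter into a word -/

/-- All words obtained from `v` by inserting the letter `x`, the insertion at the end being
listed twice. -/
def insertions (x : ℕ) : List ℕ → List (List ℕ)
  | [] => [[x], [x]]
  | a :: l => (x :: a :: l) :: (insertions x l).map (a :: ·)

/-- The sum of `f` over all insertions of `x` into `v`. -/
def insSum (x : ℕ) (f : List ℕ → ℚ) (v : List ℕ) : ℚ := ((insertions x v).map f).sum

/-- The sum of `f` over all words obtained from `v` by inserting `y, y + 1, …, y + k - 1`
successively. -/
def extSum (y : ℕ) : ℕ → (List ℕ → ℚ) → List ℕ → ℚ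
  | 0, f => f
  | k + 1, f => insSum y (extSum (y + 1) k f)

theorem insSum_nil (x : ℕ) (f : List ℕ → ℚ) : insSum x f [] = f [x] + f [x] := by
  simp [insSum, insertions]

theorem insSum_cons (x a : ℕ) (l : List ℕ) (f : List ℕ → ℚ) :
    insSum x f (a :: l) = f (x :: a :: l) + insSum x (fun w => f (a :: w)) l := by
  simp [insSum, insertions, Function.comp_def]

theorem length_of_mem_insertions {x : ℕ} {v w : List ℕ} (h : w ∈ insertions x v) :
    w.length = v.length + 1 := by
  induction v generalizing w with
  | nil => simp_all [insertions]
  | cons a l ih =>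
    simp only [insertions, List.mem_cons, List.mem_map] at h
    rcases h with rfl | ⟨u, hu, rfl⟩
    · simp
    · simp [ih hu]

theorem mem_of_mem_insertions {x : ℕ} {v w : List ℕ} (h : w ∈ insertions x v) {c : ℕ}
    (hc : c ∈ w) : c = x ∨ c ∈ v := by
  induction v generalizing w with
  | nil => simp_all [insertions]
  | cons a l ih =>
    simp only [insertions, List.mem_cons, List.mem_map] at h
    rcases h with rfl | ⟨u, hu, rfl⟩
    · simpa using hc
    · rcases List.mem_cons.1 hc with rfl | hc
      · simp
      · rcases ih hu hc with h | h <;> simp [h]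

theorem insSum_congr {x : ℕ} {f g : List ℕ → ℚ} {v : List ℕ}
    (h : ∀ w, w.length = v.length + 1 → (∀ c ∈ w, c = x ∨ c ∈ v) → f w = g w) :
    insSum x f v = insSum x g v := by
  unfold insSum
  congr 1
  exact List.map_congr_left fun w hw =>
    h w (length_of_mem_insertions hw) fun c => mem_of_mem_insertions hw

theorem insSum_add (x : ℕ) (f g : List ℕ → ℚ) (v : List ℕ) :
    insSum x (fun w => f w + g w) v = insSum x f v + insSum x g v :=
  List.sum_map_add

theorem insSum_const_mul (x : ℕ) (r : ℚ) (f : List ℕ → ℚ) (v : List ℕ) :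
    insSum x (fun w => r * f w) v = r * insSum x f v :=
  List.sum_map_mul_left _ _ _

theorem insSum_const (x : ℕ) (r : ℚ) (v : List ℕ) :
    insSum x (fun _ => r) v = (v.length + 2) * r := by
  induction v with
  | nil => rw [insSum_nil]; simp; ring
  | cons a l ih => rw [insSum_cons, ih]; simp; ring

theorem extSum_add (y k : ℕ) (f g : List ℕ → ℚ) (v : List ℕ) :
    extSum y k (fun w => f w + g w) v = extSum y k f v + extSum y k g v := by
  induction k generalizing y v with
  | zero => rfl
  | succ k ih =>
    simp only [extSum]
    rw [← insSum_add]
    congr 1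
    funext w
    exact ih _ _

theorem extSum_const_mul (y k : ℕ) (r : ℚ) (f : List ℕ → ℚ) (v : List ℕ) :
    extSum y k (fun w => r * f w) v = r * extSum y k f v := by
  induction k generalizing y v with
  | zero => rfl
  | succ k ih =>
    simp only [extSum]
    rw [← insSum_const_mul]
    congr 1
    funext w
    exact ih _ _

theorem extSum_extSum (y j k : ℕ) (f : List ℕ → ℚ) :
    extSum y j (extSum (y + j) k f) = extSum y (j + k) f := by
  induction j generalizing y with
  | zero => simp [extSum]
  | succ j ih =>
    rw [Nat.succ_add]
    simp only [extSum]
    rw [← ih, show y + (j + 1) = y + 1 + j by omega]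

theorem extSum_succ (y k : ℕ) (f : List ℕ → ℚ) :
    extSum y (k + 1) f = extSum y k (insSum (y + k) f) :=
  (extSum_extSum y k 1 f).symm

theorem extSum_congr_of_mem {y k : ℕ} {f g : List ℕ → ℚ} {v : List ℕ}
    (h : ∀ w, w.length = v.length + k → (∀ c ∈ w, c ∈ v ∨ y ≤ c ∧ c < y + k) → f w = g w) :
    extSum y k f v = extSum y k g v := by
  induction k generalizing y v with
  | zero => exact h v rfl fun c hc => Or.inl hc
  | succ k ih =>
    refine insSum_congr fun w hw hc => ih fun u hu hcu => h u (by omega) fun c hc' => ?_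
    rcases hcu c hc' with h1 | h1
    · rcases hc c h1 with rfl | h2
      · exact Or.inr (by omega)
      · exact Or.inl h2
    · exact Or.inr (by omega)

theorem extSum_congr {y k : ℕ} {f g : List ℕ → ℚ} {v : List ℕ} (hv : ∀ c ∈ v, c < y)
    (h : ∀ w, w.length = v.length + k → (∀ c ∈ w, c < y + k) → f w = g w) :
    extSum y k f v = extSum y k g v := by
  refine extSum_congr_of_mem fun w hw hc => h w hw fun c hcw => ?_
  rcases hc c hcw with h1 | h1
  · exact (hv c h1).trans_le (by omega)
  · exact h1.2

theorem insertions_map (φ : ℕ → ℕ) (x : ℕ) (v : List ℕ) :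
    insertions (φ x) (v.map φ) = (insertions x v).map (List.map φ) := by
  induction v with
  | nil => simp [insertions]
  | cons a l ih => simp [insertions, ih, Function.comp_def]

theorem extSum_map (φ : ℕ → ℕ) (y z k : ℕ) (h : ∀ i < k, φ (y + i) = z + i) (f : List ℕ → ℚ)
    (v : List ℕ) : extSum z k f (v.map φ) = extSum y k (fun w => f (w.map φ)) v := by
  induction k generalizing y z v with
  | zero => rfl
  | succ k ih =>
    have h0 : φ y = z := h 0 (by omega)
    simp only [extSum, insSum]
    rw [← h0, insertions_map, List.map_map]
    congr 1
    refine List.map_congr_left fun w _ => ?_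
    rw [h0]
    refine ih (y + 1) (z + 1) (fun i hi => ?_) w
    have := h (i + 1) (by omega)
    rw [show y + 1 + i = y + (i + 1) by omega, this]
    omega

/-! ### Occurrences of the pattern, computed recursively -/

/-- The number of occurrences of 12-3 in a word, by recursion on the word. -/
def occRec : List ℕ → ℕ
  | [] => 0
  | [_] => 0
  | a :: b :: l => (if a < b then l.countP (b < ·) else 0) + occRec (b :: l)

/-- The sum over all ascents of the number of letters from the ascent top on, plus one. -/
def ascWeight : List ℕ → ℕ
  | [] => 0
  | [_] => 0
  | a :: b :: l => (if a < b then l.length + 2 else 0) + ascWeight (b :: l)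

theorem occRec_cons_cons (a b : ℕ) (l : List ℕ) :
    occRec (a :: b :: l) = (if a < b then l.countP (b < ·) else 0) + occRec (b :: l) := rfl

theorem ascWeight_cons_cons (a b : ℕ) (l : List ℕ) :
    ascWeight (a :: b :: l) = (if a < b then l.length + 2 else 0) + ascWeight (b :: l) := rfl

theorem countP_insertions {x : ℕ} {v w : List ℕ} (h : w ∈ insertions x v) (p : ℕ → Bool) :
    w.countP p = v.countP p + if p x then 1 else 0 := by
  induction v generalizing w with
  | nil =>
    have : w = [x] := by simpa [insertions] using h
    subst this
    simp [List.countP_cons]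
  | cons a l ih =>
    simp only [insertions, List.mem_cons, List.mem_map] at h
    rcases h with rfl | ⟨u, hu, rfl⟩
    · simp [List.countP_cons]
    · simp only [List.countP_cons, ih hu]
      omega

theorem occRec_cons_of_forall_le {x : ℕ} {l : List ℕ} (h : ∀ c ∈ l, c ≤ x) :
    occRec (x :: l) = occRec l := by
  cases l with
  | nil => rfl
  | cons b l =>
    have := h b (by simp)
    rw [occRec_cons_cons, if_neg (by omega), zero_add]

theorem occRec_cons_max {a x : ℕ} {l : List ℕ} (h : ∀ c ∈ l, c < x) :
    occRec (a :: x :: l) = occRec l := by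
  have hp : l.countP (x < ·) = 0 := by
    rw [List.countP_eq_zero]
    intro c hc
    have := h c hc
    simp; omega
  rw [occRec_cons_cons, hp, ite_self, zero_add, occRec_cons_of_forall_le fun c hc => (h c hc).le]

theorem insSum_occRec {x a : ℕ} {w : List ℕ} (hw : ∀ c ∈ w, c < x) :
    insSum x (fun u => (occRec (a :: u) : ℚ)) w =
      (w.length + 1) * occRec (a :: w) + ascWeight (a :: w) := by
  induction w generalizing a with
  | nil => simp [insSum_nil, occRec, ascWeight]
  | cons b l ih =>
    have hl : ∀ c ∈ l, c < x := fun c hc => hw c (by simp [hc])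
    have hb : b < x := hw b (by simp)
    rw [insSum_cons]
    have h1 : insSum x (fun u => (occRec (a :: b :: u) : ℚ)) l =
        insSum x (fun u => ((if a < b then (l.countP (b < ·) : ℚ) + 1 else 0) +
          (occRec (b :: u) : ℚ))) l := by
      unfold insSum
      congr 1
      refine List.map_congr_left fun u hu => ?_
      rw [occRec_cons_cons, countP_insertions hu]
      split_ifs <;> simp_all
    rw [h1, insSum_add, insSum_const, ih hl, occRec_cons_max hw, occRec_cons_cons,
      ascWeight_cons_cons]
    push_cast
    simp only [List.length_cons]
    split_ifs <;> push_cast <;> ring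

theorem insSum_ascWeight {x a : ℕ} {w : List ℕ} (hw : ∀ c ∈ w, c < x) (ha : a < x) :
    insSum x (fun u => (ascWeight (a :: u) : ℚ)) w =
      (w.length + 2) * ascWeight (a :: w) + ((w.length + 2) * (w.length + 3) / 2 + 1) := by
  induction w generalizing a with
  | nil =>
    simp [insSum_nil, ascWeight, ha]
    norm_num
  | cons b l ih =>
    have hl : ∀ c ∈ l, c < x := fun c hc => hw c (by simp [hc])
    have hb : b < x := hw b (by simp)
    rw [insSum_cons]
    have h1 : insSum x (fun u => (ascWeight (a :: b :: u) : ℚ)) l =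
        insSum x (fun u => ((if a < b then (l.length : ℚ) + 3 else 0) +
          (ascWeight (b :: u) : ℚ))) l := by
      refine insSum_congr fun u hu _ => ?_
      rw [ascWeight_cons_cons, hu]
      push_cast
      split_ifs <;> ring
    rw [h1, insSum_add, insSum_const, ih hl hb, ascWeight_cons_cons, if_pos ha,
      ascWeight_cons_cons, if_neg (by omega), ascWeight_cons_cons]
    push_cast
    simp only [List.length_cons]
    split_ifs <;> push_cast <;> ring

theorem extSum_one_const (m : ℕ) (r : ℚ) :
    extSum 1 m (fun _ => r) [] = (m + 1).factorial * r := by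
  induction m generalizing r with
  | zero => simp [extSum]
  | succ m ih =>
    rw [extSum_succ, extSum_congr (g := fun _ => (m + 2 : ℚ) * r) (by simp), ih]
    · rw [Nat.factorial_succ (m + 1)]
      push_cast
      ring
    · intro w hw _
      rw [insSum_const, hw]
      simp

theorem extSum_ascWeight (m : ℕ) :
    extSum 1 m (fun w => (ascWeight (0 :: w) : ℚ)) [] =
      (m + 1).factorial * (harmonic (m + 1) - 1 + m * (m + 5) / 4) := by
  induction m with
  | zero => simp [extSum, ascWeight, harmonic_succ]
  | succ m ih =>
    rw [extSum_succ, extSum_congr (g := fun w => (m + 2 : ℚ) * ascWeight (0 :: w) +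
      ((m + 2) * (m + 3) / 2 + 1)) (by simp), extSum_add, extSum_const_mul, ih, extSum_one_const]
    · rw [Nat.factorial_succ (m + 1), harmonic_succ (m + 1)]
      have : (m : ℚ) + 1 + 1 ≠ 0 := by positivity
      push_cast
      field_simp
      ring
    · intro w hw hc
      rw [insSum_ascWeight (fun c h => hc c h) (by omega), hw]
      simp

theorem extSum_occRec (m : ℕ) :
    extSum 1 m (fun w => (occRec (0 :: w) : ℚ)) [] =
      (m + 1).factorial * (((m + 1 : ℚ) ^ 3 + 3 * (m + 1) ^ 2 - 40 * (m + 1) + 24) /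
        (12 * (m + 1)) + harmonic (m + 1)) := by
  induction m with
  | zero => norm_num [extSum, occRec, harmonic_succ]
  | succ m ih =>
    rw [extSum_succ, extSum_congr (g := fun w => (m + 1 : ℚ) * occRec (0 :: w) +
      ascWeight (0 :: w)) (by simp), extSum_add, extSum_const_mul, ih, extSum_ascWeight]
    · rw [Nat.factorial_succ (m + 1), harmonic_succ (m + 1)]
      have : (m : ℚ) + 1 + 1 ≠ 0 := by positivity
      have : (m : ℚ) + 1 ≠ 0 := by positivity
      push_cast
      field_simp
      ring
    · intro w hw hc
      rw [insSum_occRec (fun c h => hc c h), hw]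
      simp

/-! ### Counting avoiding words -/

/-- The indicator of the words avoiding 12-3. -/
def avoidInd (w : List ℕ) : ℚ := if occRec w = 0 then 1 else 0

/-- The indicator of the empty word. -/
def nilInd (w : List ℕ) : ℚ := if w = [] then 1 else 0

/-- The sum of `f v` over all factorizations `w = u v` for which `u` is weakly decreasing with
letters at most `b`. -/
def splitSum (f : List ℕ → ℚ) : ℕ → List ℕ → ℚ
  | _, [] => f []
  | b, a :: l => f (a :: l) + if a ≤ b then splitSum f a l else 0

theorem splitSum_cons (f : List ℕ → ℚ) (b a : ℕ) (l : List ℕ) :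
    splitSum f b (a :: l) = f (a :: l) + if a ≤ b then splitSum f a l else 0 := rfl

theorem splitSum_zero (b : ℕ) (w : List ℕ) : splitSum (fun _ => 0) b w = 0 := by
  induction w generalizing b with
  | nil => rfl
  | cons a l ih => simp [splitSum, ih]

theorem splitSum_congr {f g : List ℕ → ℚ} {b : ℕ} {w : List ℕ}
    (h : ∀ v, v <:+ w → f v = g v) : splitSum f b w = splitSum g b w := by
  induction w generalizing b with
  | nil => exact h [] (List.suffix_refl _)
  | cons a l ih =>
    rw [splitSum_cons, splitSum_cons, h _ (List.suffix_refl _),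
      ih fun v hv => h v (hv.trans (List.suffix_cons a l))]

theorem splitSum_bound_congr (f : List ℕ → ℚ) {b b' : ℕ} {w : List ℕ}
    (h : ∀ c ∈ w, c ≤ b) (h' : ∀ c ∈ w, c ≤ b') : splitSum f b w = splitSum f b' w := by
  cases w with
  | nil => rfl
  | cons a l =>
    rw [splitSum_cons, splitSum_cons, if_pos (h a (by simp)), if_pos (h' a (by simp))]

theorem insSum_splitSum {x b : ℕ} (f : List ℕ → ℚ) {w : List ℕ} (hw : ∀ c ∈ w, c < x) :
    insSum x (splitSum f b) w =
      (if x ≤ b then splitSum f x w + (if w = [] then f [] else 0) else 0) +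
        splitSum (insSum x f) b w := by
  induction w generalizing b with
  | nil =>
    simp only [insSum_nil, splitSum, if_true]
    split_ifs <;> ring
  | cons a l ih =>
    have ha : a < x := hw a (by simp)
    rw [insSum_cons, splitSum_cons f b x, splitSum_cons (insSum x f), insSum_cons]
    have h1 : insSum x (fun u => splitSum f b (a :: u)) l =
        insSum x (fun u => f (a :: u)) l + if a ≤ b then splitSum (insSum x f) a l else 0 := by
      simp only [splitSum_cons]
      rw [insSum_add]
      congr 1
      by_cases hab : a ≤ b
      · simp only [if_pos hab]
        rw [ih fun c hc => hw c (by simp [hc]), if_neg (by omega), zero_add]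
      · simp only [if_neg hab]
        rw [insSum_const, mul_zero]
    rw [h1, if_neg (List.cons_ne_nil a l), add_zero]
    ring

theorem insSum_avoidInd_cons {x a : ℕ} {w : List ℕ} (hw : ∀ c ∈ w, c < x) :
    insSum x (fun u => avoidInd (a :: u)) w = splitSum avoidInd a w + splitSum nilInd a w := by
  induction w generalizing a with
  | nil => simp [insSum_nil, splitSum, avoidInd, nilInd, occRec]
  | cons b l ih =>
    have hb : b < x := hw b (by simp)
    rw [insSum_cons, splitSum_cons, splitSum_cons]
    have h0 : avoidInd (a :: x :: b :: l) = avoidInd (b :: l) := by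
      simp only [avoidInd, occRec_cons_max hw]
    have h1 : insSum x (fun u => avoidInd (a :: b :: u)) l =
        if b ≤ a then splitSum avoidInd b l + splitSum nilInd b l else 0 := by
      split_ifs with hab
      · rw [← ih fun c hc => hw c (by simp [hc])]
        congr 1
        funext u
        simp only [avoidInd]
        rw [occRec_cons_cons, if_neg (show ¬a < b by omega), zero_add]
      · refine Eq.trans ?_ ((insSum_const x 0 l).trans (mul_zero _))
        unfold insSum
        congr 1
        refine List.map_congr_left fun u hu => ?_
        rw [avoidInd, if_neg]
        rw [occRec_cons_cons, if_pos (by omega), countP_insertions hu]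
        simp [hb]
    rw [h0, h1]
    simp only [nilInd, reduceCtorEq, if_false]
    split_ifs <;> ring

theorem insSum_avoidInd {x : ℕ} {w : List ℕ} (hw : ∀ c ∈ w, c < x) :
    insSum x avoidInd w = splitSum avoidInd x w + splitSum nilInd x w := by
  rw [← insSum_avoidInd_cons hw]
  refine insSum_congr fun u _ hu => ?_
  rw [avoidInd, avoidInd, occRec_cons_of_forall_le]
  intro c hc
  rcases hu c hc with rfl | h
  · exact le_rfl
  · exact (hw c h).le

theorem occRec_map {φ : ℕ → ℕ} (hφ : StrictMono φ) (w : List ℕ) :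
    occRec (w.map φ) = occRec w := by
  induction w with
  | nil => rfl
  | cons a l ih =>
    cases l with
    | nil => rfl
    | cons b l =>
      simp only [List.map_cons] at ih ⊢
      rw [occRec_cons_cons, occRec_cons_cons, ih, List.countP_map]
      simp only [hφ.lt_iff_lt, Function.comp_def]

theorem extSum_avoidInd_shift (y k : ℕ) {v : List ℕ} (hv : ∀ c ∈ v, c < y) :
    extSum (y + 1) k avoidInd v = extSum y k avoidInd v := by
  set φ : ℕ → ℕ := fun a => if a < y then a else a + 1 with hφ
  have hmono : StrictMono φ := by
    intro a b hab
    simp only [hφ]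
    split_ifs <;> omega
  have hmap : v.map φ = v :=
    (List.map_congr_left fun c hc => by simp [hφ, hv c hc]).trans (List.map_id v)
  have := extSum_map φ y (y + 1) k (fun i _ => by simp [hφ]; omega) avoidInd v
  rw [hmap] at this
  rw [this]
  congr 1
  funext w
  rw [avoidInd, avoidInd, occRec_map hmono]

/-- The number of avoiding words on `m` letters, each weighted by a factor `2` for every
right-to-left minimum. -/
def avoidSum (m : ℕ) : ℚ := extSum 0 m avoidInd []

/-- The sum over all words on `m + 1` letters and their factorizations `w = u v` with `u`
decreasing of the number of avoiding words arising from `v` by inserting `k` new letters. -/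
def avoidSplitSum (m k : ℕ) : ℚ :=
  extSum 0 (m + 1) (splitSum (extSum (m + 1) k avoidInd) (m + 1)) []

theorem avoidSplitSum_zero (k : ℕ) :
    avoidSplitSum 0 k = avoidSum (k + 1) + 2 * avoidSum k := by
  have h := extSum_avoidInd_shift 0 k (v := []) (by simp)
  simp only [avoidSplitSum, avoidSum, extSum, insSum_nil, splitSum, zero_add, zero_le,
    if_true] at h ⊢
  rw [h]
  ring

theorem avoidSplitSum_succ (m k : ℕ) :
    avoidSplitSum (m + 1) k = avoidSplitSum m k + avoidSplitSum m (k + 1) := by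
  unfold avoidSplitSum
  rw [extSum_succ, ← extSum_add]
  refine extSum_congr (by simp) fun w hw hc => ?_
  have hc' : ∀ c ∈ w, c < m + 1 := fun c h => (hc c h).trans_eq (by omega)
  have hne : w ≠ [] := by
    rintro rfl
    simp at hw
  rw [show 0 + (m + 1) = m + 1 by omega, insSum_splitSum _ hc', if_pos (by omega), if_neg hne,
    add_zero]
  congr 1
  · exact splitSum_congr fun v hv => extSum_avoidInd_shift _ _ fun c h => hc' c (hv.subset h)
  · exact splitSum_bound_congr _ (fun c h => (hc' c h).le.trans (by omega)) fun c h =>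
      (hc' c h).le

theorem avoidSplitSum_eq_sum (m k : ℕ) :
    avoidSplitSum m k = ∑ j ∈ range (m + 1), (m.choose j : ℚ) * avoidSplitSum 0 (k + j) := by
  induction m generalizing k with
  | zero => simp
  | succ m ih =>
    rw [avoidSplitSum_succ, ih, ih, sum_range_choose_succ_mul fun j => avoidSplitSum 0 (k + j),
      ← Finset.sum_add_distrib]
    refine Finset.sum_congr rfl fun j _ => ?_
    rw [← mul_add, show k + 1 + j = k + (j + 1) by omega]

theorem extSum_splitSum_nilInd (m : ℕ) :
    extSum 0 (m + 1) (splitSum nilInd (m + 1)) [] = 2 := by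
  induction m with
  | zero => norm_num [extSum, insSum_nil, splitSum, nilInd]
  | succ m ih =>
    rw [extSum_succ, ← ih]
    refine extSum_congr (by simp) fun w hw hc => ?_
    have hc' : ∀ c ∈ w, c < m + 1 := fun c h => (hc c h).trans_eq (by omega)
    have hne : w ≠ [] := by
      rintro rfl
      simp at hw
    have hz : insSum (m + 1) nilInd = fun _ => 0 := by
      funext v
      cases v with
      | nil => simp [insSum_nil, nilInd]
      | cons a l => simp [insSum_cons, nilInd, insSum_const]
    rw [show 0 + (m + 1) = m + 1 by omega, insSum_splitSum _ hc', if_pos (by omega), if_neg hne,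
      hz, splitSum_zero]
    simp

theorem avoidSum_zero : avoidSum 0 = 1 := by
  simp [avoidSum, extSum, avoidInd, occRec]

theorem avoidSum_one : avoidSum 1 = 2 := by
  norm_num [avoidSum, extSum, insSum_nil, avoidInd, occRec]

theorem avoidSum_add_two (m : ℕ) :
    avoidSum (m + 2) =
      ∑ j ∈ range (m + 1), (m.choose j : ℚ) * (avoidSum (j + 1) + 2 * avoidSum j) + 2 := by
  have h : avoidSum (m + 2) = avoidSplitSum m 0 + 2 := by
    rw [avoidSum, extSum_succ, ← extSum_splitSum_nilInd m, avoidSplitSum, ← extSum_add]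
    refine extSum_congr (by simp) fun w _ hc => ?_
    rw [insSum_avoidInd hc, zero_add]
    rfl
  rw [h, avoidSplitSum_eq_sum]
  simp only [zero_add, avoidSplitSum_zero]

theorem avoidSum_eq_bellConv (m : ℕ) : avoidSum (m + 1) = bellConv (m + 1) := by
  induction m using Nat.strong_induction_on with
  | _ m ih =>
    cases m with
    | zero => rw [avoidSum_one, bellConv_one]
    | succ m =>
      rw [avoidSum_add_two, bellConv_add_two, Finset.sum_range_succ', Finset.sum_range_succ' _ m,
        avoidSum_zero, bellConv_zero, ih 0 (by omega)]
      have h : ∀ j ∈ range m,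
          (m.choose (j + 1) : ℚ) * (avoidSum (j + 1 + 1) + 2 * avoidSum (j + 1)) =
          (m.choose (j + 1) : ℚ) * (bellConv (j + 1 + 1) + 2 * bellConv (j + 1)) := by
        intro j hj
        have := Finset.mem_range.1 hj
        rw [ih (j + 1) (by omega), ih j (by omega)]
      rw [Finset.sum_congr rfl h]
      simp
      ring

theorem extSum_avoidInd_zero_cons (m : ℕ) :
    extSum 1 (m + 2) (fun w => avoidInd (0 :: w)) [] = avoidSum (m + 1) := by
  have h := extSum_avoidInd_shift 0 (m + 1) (v := []) (by simp)
  rw [avoidSum, ← h, extSum_succ]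
  refine extSum_congr_of_mem fun w hw hc => ?_
  have hc' : ∀ c ∈ w, 1 ≤ c ∧ c < 1 + (m + 1) := fun c h => by simpa using hc c h
  rw [insSum_avoidInd_cons fun c h => (hc' c h).2]
  cases w with
  | nil => simp at hw
  | cons b l =>
    have hb := (hc' b (by simp)).1
    rw [splitSum_cons, splitSum_cons, if_neg (by omega), if_neg (by omega)]
    simp [nilInd]

/-! ### The recursive count agrees with the count of positions -/

theorem sum_fin_ite_get_eq_countP {n : ℕ} (l : List (Fin n)) (b : Fin n) :
    (∑ i : Fin l.length, if b < l.get i then 1 else 0) =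
      (l.map Fin.val).countP ((b : ℕ) < ·) := by
  induction l with
  | nil => simp
  | cons a l ih =>
    have := Fin.sum_univ_succ (fun i : Fin (l.length + 1) => if b < (a :: l).get i then 1 else 0)
    simp only [List.length_cons]
    rw [this, List.map_cons, List.countP_cons, ← ih]
    by_cases h : b < a <;> simp [h, add_comm]

theorem occ_eq_sum {n : ℕ} (w : List (Fin n)) :
    occ w = ∑ p : Fin w.length, ∑ q : Fin w.length, ∑ r : Fin w.length,
      if (p : ℕ) + 1 = q ∧ (q : ℕ) < r ∧ w.get p < w.get q ∧ w.get q < w.get r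
        then 1 else 0 := by
  classical
  unfold occ
  rw [Finset.card_filter, Fintype.sum_prod_type]
  refine Finset.sum_congr rfl fun p _ => ?_
  rw [Fintype.sum_prod_type]
  refine Finset.sum_congr rfl fun q _ => Finset.sum_congr rfl fun r _ => ?_
  simp only [IsOcc, Fin.lt_def]

theorem occ_eq_occRec {n : ℕ} (w : List (Fin n)) : occ w = occRec (w.map Fin.val) := by
  induction w with
  | nil => simp [occ_eq_sum, occRec]
  | cons a w ih =>
    cases w with
    | nil => simp [occ_eq_sum, occRec]
    | cons b l =>
      rw [List.map_cons, List.map_cons, occRec_cons_cons, ← List.map_cons, ← ih,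
        ← sum_fin_ite_get_eq_countP, occ_eq_sum, occ_eq_sum]
      simp only [List.length_cons]
      rw [Fin.sum_univ_succ (n := l.length + 1)]
      congr 1
      · rw [Fin.sum_univ_succ (n := l.length + 1), Fin.sum_univ_succ (n := l.length)]
        simp only [Fin.sum_univ_succ (n := l.length + 1), Fin.sum_univ_succ (n := l.length)]
        simp
        split_ifs with h <;> simp [h]
      · refine Finset.sum_congr rfl fun p _ => ?_
        rw [Fin.sum_univ_succ (n := l.length + 1)]
        simp only [Fin.sum_univ_succ (n := l.length + 1)]
        simp

theorem avoids_iff_occRec_eq_zero {n : ℕ} (w : List (Fin n)) :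
    Avoids w ↔ occRec (w.map Fin.val) = 0 := by
  classical
  rw [← occ_eq_occRec, occ, Finset.card_eq_zero, Finset.filter_eq_empty_iff, Avoids]
  simp

/-! ### Inserting a new largest element into a permutation -/

theorem mem_cycleWord {n : ℕ} (π : Equiv.Perm (Fin n)) (i j : Fin n) :
    j ∈ cycleWord π i ↔ π.SameCycle i j := by
  unfold cycleWord
  rw [List.mem_iterate]
  have hp : Function.IsPeriodicPt π (orderOf π) i := by
    rw [Function.IsPeriodicPt, Function.IsFixedPt, ← Equiv.Perm.coe_pow, pow_orderOf_eq_one]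
    rfl
  have hpos : 0 < Function.minimalPeriod π i := hp.minimalPeriod_pos (orderOf_pos π)
  constructor
  · rintro ⟨m, _, rfl⟩
    exact ⟨m, by rw [zpow_natCast, Equiv.Perm.coe_pow]⟩
  · intro h
    obtain ⟨m, rfl⟩ := h.exists_nat_pow_eq
    refine ⟨m % Function.minimalPeriod π i, Nat.mod_lt _ hpos, ?_⟩
    rw [Function.iterate_mod_minimalPeriod_eq, Equiv.Perm.coe_pow]

theorem isCycleMin_iff {n : ℕ} (π : Equiv.Perm (Fin n)) (i : Fin n) :
    IsCycleMin π i ↔ ∀ j ∈ cycleWord π i, i ≤ j := by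
  simp only [IsCycleMin, mem_cycleWord]

theorem nodup_cycleWord {n : ℕ} (π : Equiv.Perm (Fin n)) (i : Fin n) :
    (cycleWord π i).Nodup := by
  unfold cycleWord
  rw [List.nodup_iff_injective_get]
  intro p q h
  simp only [List.get_eq_getElem, List.getElem_iterate] at h
  have hp := p.2
  have hq := q.2
  simp only [List.length_iterate] at hp hq
  exact Fin.ext (Function.iterate_injOn_Iio_minimalPeriod hp hq h)

theorem cycleWord_eq_of_nodup {n : ℕ} (π : Equiv.Perm (Fin n)) (i : Fin n) (m : ℕ)
    (hm : 0 < m) (hp : π^[m] i = i) (hnd : (List.iterate π i m).Nodup) :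
    cycleWord π i = List.iterate π i m := by
  have hp' : Function.IsPeriodicPt π m i := hp
  have hle := hp'.minimalPeriod_le hm
  have hpos := hp'.minimalPeriod_pos hm
  rcases hle.eq_or_lt with h | h
  · rw [cycleWord, h]
  · exfalso
    have h1 := (List.Nodup.getElem_inj_iff hnd (i := Function.minimalPeriod π i) (j := 0)
      (hi := by simpa using h) (hj := by simpa using hm)).1 (by
        simp [List.getElem_iterate])
    omega

/-- `π` arises from `σ` by inserting the new largest element behind `k` in its cycle, or as a
new fixed point if `k = none`. -/
def IsMaxInsertion {n : ℕ} (π : Equiv.Perm (Fin (n + 1))) (σ : Equiv.Perm (Fin n))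
    (k : Option (Fin n)) : Prop :=
  (∀ a, π a.castSucc = if k = some a then Fin.last n else (σ a).castSucc) ∧
    π (Fin.last n) = k.elim (Fin.last n) fun a => (σ a).castSucc

/-- The word replacing the letter `a` when the new largest letter is inserted behind `k`. -/
def blowUp {n : ℕ} (k : Option (Fin n)) (a : Fin n) : List (Fin (n + 1)) :=
  if k = some a then [a.castSucc, Fin.last n] else [a.castSucc]

theorem mem_blowUp {n : ℕ} {k : Option (Fin n)} {a : Fin n} {c : Fin (n + 1)} :
    c ∈ blowUp k a ↔ c = a.castSucc ∨ k = some a ∧ c = Fin.last n := by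
  unfold blowUp
  split_ifs with h <;> simp [h]

theorem nodup_flatMap_blowUp {n : ℕ} (k : Option (Fin n)) {w : List (Fin n)} (hw : w.Nodup) :
    (w.flatMap (blowUp k)).Nodup := by
  rw [List.nodup_flatMap]
  refine ⟨fun a _ => ?_, hw.imp fun {a b} hab => ?_⟩
  · unfold blowUp
    split_ifs <;> simp [Fin.castSucc_ne_last]
  · intro c hc hc'
    rw [mem_blowUp] at hc hc'
    rcases hc with rfl | ⟨h1, rfl⟩ <;> rcases hc' with h | ⟨h2, h⟩
    · exact hab (Fin.castSucc_injective _ h)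
    · exact Fin.castSucc_ne_last _ h
    · exact Fin.castSucc_ne_last _ h.symm
    · exact hab (Option.some_injective _ (h1.symm.trans h2))

namespace IsMaxInsertion

variable {n : ℕ} {π : Equiv.Perm (Fin (n + 1))} {σ : Equiv.Perm (Fin n)} {k : Option (Fin n)}

theorem flatMap_iterate (h : IsMaxInsertion π σ k) (j : Fin n) (m : ℕ) :
    ∃ p, m ≤ p ∧ (List.iterate σ j m).flatMap (blowUp k) = List.iterate π j.castSucc p ∧
      π^[p] j.castSucc = (σ^[m] j).castSucc := by
  induction m generalizing j with
  | zero => exact ⟨0, le_rfl, rfl, rfl⟩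
  | succ m ih =>
    obtain ⟨p, hp, h1, h2⟩ := ih (σ j)
    simp only [List.iterate, List.flatMap_cons, h1]
    by_cases hk : k = some j
    · have e1 : π j.castSucc = Fin.last n := by rw [h.1, if_pos hk]
      have e2 : π (Fin.last n) = (σ j).castSucc := by rw [h.2, hk]; rfl
      refine ⟨p + 2, by omega, ?_, ?_⟩
      · simp [blowUp, hk, List.iterate, e1, e2]
      · simp [Function.iterate_succ_apply, e1, e2, h2]
    · have e1 : π j.castSucc = (σ j).castSucc := by rw [h.1, if_neg hk]
      refine ⟨p + 1, by omega, ?_, ?_⟩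
      · simp [blowUp, hk, List.iterate, e1]
      · simp [Function.iterate_succ_apply, e1, h2]

theorem cycleWord_castSucc (h : IsMaxInsertion π σ k) (i : Fin n) :
    cycleWord π i.castSucc = (cycleWord σ i).flatMap (blowUp k) := by
  obtain ⟨p, hp, h1, h2⟩ := h.flatMap_iterate i (Function.minimalPeriod σ i)
  have hpos : 0 < Function.minimalPeriod σ i := by
    have : i ∈ cycleWord σ i := (mem_cycleWord σ i i).2 (Equiv.Perm.SameCycle.refl σ i)
    have := List.length_pos_of_mem this
    simpa [cycleWord] using this
  have hnd := nodup_flatMap_blowUp k (nodup_cycleWord σ i)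
  rw [cycleWord, h1] at hnd
  rw [cycleWord_eq_of_nodup π _ p (by omega) _ hnd, cycleWord, h1]
  rw [h2, Function.iterate_minimalPeriod]

theorem isCycleMin_castSucc (h : IsMaxInsertion π σ k) (i : Fin n) :
    IsCycleMin π i.castSucc ↔ IsCycleMin σ i := by
  rw [isCycleMin_iff, isCycleMin_iff, h.cycleWord_castSucc]
  simp only [List.mem_flatMap, mem_blowUp]
  constructor
  · intro H j hj
    exact Fin.castSucc_le_castSucc_iff.1 (H _ ⟨j, hj, Or.inl rfl⟩)
  · rintro H _ ⟨a, ha, rfl | ⟨_, rfl⟩⟩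
    · exact Fin.castSucc_le_castSucc_iff.2 (H a ha)
    · exact Fin.le_last _

theorem isCycleMin_last (h : IsMaxInsertion π σ k) :
    IsCycleMin π (Fin.last n) ↔ k = none := by
  constructor
  · intro H
    cases k with
    | none => rfl
    | some a =>
      have h1 : π.SameCycle (Fin.last n) (σ a).castSucc := ⟨1, by simp [h.2]⟩
      exact absurd (H _ h1) (not_le.2 (Fin.castSucc_lt_last _))
  · rintro rfl j ⟨m, rfl⟩
    have h1 : π (Fin.last n) = Fin.last n := h.2
    rw [Equiv.Perm.zpow_apply_eq_self_of_apply_eq_self h1]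

theorem flatten_eq (h : IsMaxInsertion π σ k) :
    flatten π = (flatten σ).flatMap (blowUp k) ++ if k = none then [Fin.last n] else [] := by
  classical
  have h1 : ((List.finRange n).map Fin.castSucc).filter (fun i => IsCycleMin π i) =
      ((List.finRange n).filter (fun i => IsCycleMin σ i)).map Fin.castSucc := by
    rw [List.filter_map]
    congr 1
    refine List.filter_congr fun i _ => ?_
    simp [h.isCycleMin_castSucc]
  have h2 : ∀ L : List (Fin n), ((L.map Fin.castSucc).map (cycleWord π)).flatten =
      ((L.map (cycleWord σ)).flatten).flatMap (blowUp k) := by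
    intro L
    induction L with
    | nil => rfl
    | cons a L ih =>
      simp only [List.map_cons, List.flatten_cons, List.flatMap_append, ih, h.cycleWord_castSucc]
  have h3 : flatten π = ((((List.finRange n).map Fin.castSucc ++ [Fin.last n]).filter
      (fun i => IsCycleMin π i)).map (cycleWord π)).flatten := by
    rw [← List.finRange_succ_last]
    unfold flatten standardCycleForm
    congr!
  rw [h3, List.filter_append, h1, List.map_append, List.flatten_append, h2]
  congr 1
  · split_ifs with hk
    · have hl : π (Fin.last n) = Fin.last n := by rw [h.2, hk]; rfl
      have : cycleWord π (Fin.last n) = [Fin.last n] :=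
        cycleWord_eq_of_nodup π _ 1 one_pos hl (by simp)
      simp [h.isCycleMin_last, hk, this]
    · simp [h.isCycleMin_last, hk]

end IsMaxInsertion

/-- Every permutation of `n + 1` letters arises in a unique way by inserting the largest letter
into a permutation of `n` letters. -/
def maxInsertionEquiv (n : ℕ) :
    Option (Fin n) × Equiv.Perm (Fin n) ≃ Equiv.Perm (Fin (n + 1)) :=
  (((Equiv.refl _).prodCongr (Equiv.inv _)).trans Equiv.Perm.decomposeOption.symm).trans
    ((Equiv.inv _).trans finSuccEquivLast.symm.permCongr)

theorem isMaxInsertion_maxInsertionEquiv {n : ℕ} (k : Option (Fin n)) (σ : Equiv.Perm (Fin n)) :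
    IsMaxInsertion (maxInsertionEquiv n (k, σ)) σ k := by
  have hs : (Equiv.optionCongr σ⁻¹).symm = Equiv.optionCongr σ := Equiv.optionCongr_symm _
  constructor
  · intro a
    cases k with
    | none => simp [maxInsertionEquiv, Equiv.permCongr_apply, hs]
    | some k =>
      by_cases h : k = a
      · subst h
        simp [maxInsertionEquiv, Equiv.permCongr_apply, hs]
      · have h' : a ≠ k := fun e => h e.symm
        simp [maxInsertionEquiv, Equiv.permCongr_apply, hs, h, h', Equiv.swap_apply_of_ne_of_ne]
  · cases k <;> simp [maxInsertionEquiv, Equiv.permCongr_apply, hs]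

theorem exists_isMaxInsertion {n : ℕ} (π : Equiv.Perm (Fin (n + 1))) :
    ∃ σ k, IsMaxInsertion π σ k := by
  obtain ⟨⟨k, σ⟩, rfl⟩ := (maxInsertionEquiv n).surjective π
  exact ⟨σ, k, isMaxInsertion_maxInsertionEquiv k σ⟩

theorem flatten_perm_finRange {n : ℕ} (π : Equiv.Perm (Fin n)) :
    (flatten π).Perm (List.finRange n) := by
  have key : (flatten π).Nodup ∧ ∀ i, i ∈ flatten π := by
    induction n with
    | zero => exact ⟨by simp [flatten, standardCycleForm], fun i => i.elim0⟩
    | succ n ih =>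
      obtain ⟨σ, k, h⟩ := exists_isMaxInsertion π
      obtain ⟨h1, h2⟩ := ih σ
      rw [h.flatten_eq]
      constructor
      · refine List.Nodup.append (nodup_flatMap_blowUp k h1) (by split_ifs <;> simp) ?_
        intro c hc hc'
        split_ifs at hc' with hk
        · subst hk
          simp only [List.mem_singleton] at hc'
          subst hc'
          simp [List.mem_flatMap, mem_blowUp, (Fin.castSucc_ne_last _).symm] at hc
        · simp at hc'
      · intro i
        rw [List.mem_append]
        induction i using Fin.lastCases with
        | last =>
          cases k with
          | none => right; simp
          | some a =>
            left
            exact List.mem_flatMap.2 ⟨a, h2 a, mem_blowUp.2 (Or.inr ⟨rfl, rfl⟩)⟩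
        | cast a => exact Or.inl (List.mem_flatMap.2 ⟨a, h2 a, mem_blowUp.2 (Or.inl rfl)⟩)
  rw [List.perm_ext_iff_of_nodup key.1 (List.nodup_finRange n)]
  simp [key.2]

/-- The flattened word with letters in `ℕ`. -/
noncomputable def natWord {n : ℕ} (π : Equiv.Perm (Fin n)) : List ℕ := (flatten π).map Fin.val

theorem exists_natWord_eq_cons {n : ℕ} (π : Equiv.Perm (Fin (n + 1))) :
    ∃ l, natWord π = 0 :: l := by
  classical
  have h0 : IsCycleMin π 0 := fun j _ => Fin.zero_le j
  have h1 : 0 ∈ cycleWord π 0 := (mem_cycleWord π 0 0).2 (Equiv.Perm.SameCycle.refl π 0)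
  obtain ⟨t, ht⟩ : ∃ t, cycleWord π 0 = 0 :: t := by
    cases hp : Function.minimalPeriod π 0 with
    | zero => simp [cycleWord, hp] at h1
    | succ m => exact ⟨_, by rw [cycleWord, hp, List.iterate]⟩
  unfold natWord flatten standardCycleForm
  rw [List.finRange_succ, List.filter_cons_of_pos (by simpa using h0), List.map_cons,
    List.flatten_cons, ht]
  exact ⟨_, rfl⟩

theorem flatMap_blowUp_of_notMem {n : ℕ} {k : Option (Fin n)} {w : List (Fin n)}
    (h : ∀ a ∈ w, k ≠ some a) :
    (w.flatMap (blowUp k)).map Fin.val = w.map Fin.val := by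
  induction w with
  | nil => rfl
  | cons a l ih =>
    rw [List.flatMap_cons, List.map_append, ih fun b hb => h b (by simp [hb])]
    simp [blowUp, h a (by simp)]

theorem sum_flatMap_blowUp {n : ℕ} (F : List ℕ → ℚ) (b : Fin n) (l : List (Fin n))
    (h : (b :: l).Nodup) :
    ((b :: l).map fun a => F (((b :: l).flatMap (blowUp (some a))).map Fin.val)).sum +
        F ((b :: l).map Fin.val ++ [n]) =
      insSum n (fun u => F ((b : ℕ) :: u)) (l.map Fin.val) := by
  induction l generalizing F b with
  | nil => simp [insSum_nil, blowUp]
  | cons c l ih =>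
    obtain ⟨hb, hnd⟩ := List.nodup_cons.1 h
    have hfirst : ((b :: c :: l).flatMap (blowUp (some b))).map Fin.val =
        (b : ℕ) :: n :: (c :: l).map Fin.val := by
      rw [List.flatMap_cons, List.map_append, flatMap_blowUp_of_notMem (w := c :: l)]
      · simp [blowUp]
      · rintro a ha e
        rw [Option.some.injEq] at e
        exact hb (e ▸ ha)
    have hrest : ∀ a ∈ c :: l, F (((b :: c :: l).flatMap (blowUp (some a))).map Fin.val) =
        F ((b : ℕ) :: ((c :: l).flatMap (blowUp (some a))).map Fin.val) := by
      intro a ha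
      have hab : a ≠ b := fun e => hb (e ▸ ha)
      rw [List.flatMap_cons, List.map_append]
      simp [blowUp, hab]
    rw [List.map_cons, List.sum_cons, hfirst, List.map_congr_left hrest, List.map_cons (l := l),
      insSum_cons, ← ih (fun u => F ((b : ℕ) :: u)) c hnd, add_assoc]
    rfl

theorem sum_natWord_succ (n : ℕ) (F : List ℕ → ℚ) :
    ∑ π : Equiv.Perm (Fin (n + 2)), F (natWord π) =
      ∑ σ : Equiv.Perm (Fin (n + 1)), insSum (n + 1) (fun u => F (0 :: u)) (natWord σ).tail := by
  rw [← (maxInsertionEquiv (n + 1)).sum_comp, Fintype.sum_prod_type_right]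
  refine Finset.sum_congr rfl fun σ _ => ?_
  rw [Fintype.sum_option]
  have hword : ∀ k, natWord (maxInsertionEquiv (n + 1) (k, σ)) =
      ((flatten σ).flatMap (blowUp k)).map Fin.val ++ if k = none then [n + 1] else [] := by
    intro k
    rw [natWord, (isMaxInsertion_maxInsertionEquiv k σ).flatten_eq, List.map_append]
    split_ifs <;> simp
  have hperm := flatten_perm_finRange σ
  obtain ⟨t, ht⟩ := exists_natWord_eq_cons σ
  have hnd : (flatten σ).Nodup := hperm.nodup_iff.2 (List.nodup_finRange _)
  simp only [hword, if_true, reduceCtorEq, if_false, List.append_nil]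
  rw [flatMap_blowUp_of_notMem (by simp), Fin.sum_univ_def, ← (hperm.map _).sum_eq, add_comm]
  simp only [natWord] at ht ⊢
  cases hf : flatten σ with
  | nil => simp [hf] at ht
  | cons b l =>
    rw [hf] at hnd ht
    have hb : (b : ℕ) = 0 := by
      simp only [List.map_cons, List.cons.injEq] at ht
      exact ht.1
    rw [sum_flatMap_blowUp F b l hnd, hb]
    rfl

theorem sum_natWord (m : ℕ) (F : List ℕ → ℚ) :
    ∑ π : Equiv.Perm (Fin (m + 1)), F (natWord π) = extSum 1 m (fun w => F (0 :: w)) [] := by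
  induction m generalizing F with
  | zero =>
    have h : ∀ π : Equiv.Perm (Fin (0 + 1)), natWord π = [0] := by
      intro π
      obtain ⟨l, hl⟩ := exists_natWord_eq_cons π
      have hlen : (natWord π).length = 1 := by
        rw [natWord, List.length_map, (flatten_perm_finRange _).length_eq, List.length_finRange]
      rw [hl] at hlen ⊢
      rw [List.length_cons, Nat.add_eq_right, List.length_eq_zero_iff] at hlen
      rw [hlen]
    simp only [h, Finset.sum_const, Finset.card_univ, Fintype.card_perm, Fintype.card_fin]
    simp [extSum]
  | succ m ih =>
    rw [sum_natWord_succ, ih fun w => insSum (m + 1) (fun u => F (0 :: u)) w.tail, extSum_succ,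
      add_comm 1 m]
    rfl

theorem numAvoiding_succ (m : ℕ) :
    (numAvoiding (m + 1) : ℚ) = extSum 1 m (fun w => avoidInd (0 :: w)) [] := by
  classical
  rw [← sum_natWord, numAvoiding, Finset.card_filter]
  push_cast
  refine Finset.sum_congr rfl fun π _ => ?_
  simp only [avoids_iff_occRec_eq_zero, avoidInd, natWord]
  congr

theorem numAvoiding_add_three (m : ℕ) : (numAvoiding (m + 3) : ℚ) = bellConv (m + 1) := by
  rw [numAvoiding_succ, extSum_avoidInd_zero_cons, avoidSum_eq_bellConv]

theorem avgOcc_succ (m : ℕ) :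
    avgOcc (m + 1) = ((m + 1 : ℚ) ^ 3 + 3 * (m + 1) ^ 2 - 40 * (m + 1) + 24) /
        (12 * (m + 1)) + harmonic (m + 1) := by
  have h : ∑ π : Equiv.Perm (Fin (m + 1)), (occ (flatten π) : ℚ) =
      ∑ π : Equiv.Perm (Fin (m + 1)), (occRec (natWord π) : ℚ) :=
    Finset.sum_congr rfl fun π _ => by rw [occ_eq_occRec, natWord]
  rw [avgOcc, h, sum_natWord m fun w => (occRec w : ℚ), extSum_occRec, Fintype.card_perm,
    Fintype.card_fin]
  exact mul_div_cancel_left₀ _ (Nat.cast_ne_zero.2 (Nat.factorial_ne_zero _))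

end FlattenedPattern

theorem mainTheorem5 (n : ℕ) (hn : 2 ≤ n) :
    (3 ≤ n →
      (FlattenedPattern.numAvoiding n : ℤ) =
        -2 * ∑ i ∈ Finset.range (n - 1),
          ((n - 2).choose i : ℤ) * ((Nat.bell i : ℤ) + (Nat.bell (i + 1) : ℤ)) *
            FlattenedPattern.complBell ((n : ℤ) - (i : ℤ) - 3)) ∧
    (n = 2 → FlattenedPattern.numAvoiding n = 2) ∧
    FlattenedPattern.avgOcc n =
      ((n : ℚ) ^ 3 + 3 * (n : ℚ) ^ 2 - 40 * (n : ℚ) + 24) / (12 * (n : ℚ)) + harmonic n := by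
  refine ⟨fun h3 => ?_, ?_, ?_⟩
  · obtain ⟨m, rfl⟩ := Nat.exists_eq_add_of_le' h3
    have h := FlattenedPattern.numAvoiding_add_three m
    rw [FlattenedPattern.bellConv] at h
    have h' : ((FlattenedPattern.numAvoiding (m + 3) : ℤ) : ℚ) =
        ((-2 * ∑ i ∈ Finset.range (m + 1 + 1), ((m + 1).choose i : ℤ) *
          ((Nat.bell i : ℤ) + (Nat.bell (i + 1) : ℤ)) *
            FlattenedPattern.complBell (((m + 1 - i : ℕ) : ℤ) - 1) : ℤ) : ℚ) := by
      push_cast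
      exact h
    rw [Int.cast_inj.1 h']
    refine congrArg (-2 * ·) (Finset.sum_congr rfl fun i hi => ?_)
    have hi' : i ≤ m + 1 := Nat.lt_succ_iff.1 (Finset.mem_range.1 hi)
    have harg : ((m + 1 - i : ℕ) : ℤ) - 1 = ((m + 3 : ℕ) : ℤ) - (i : ℤ) - 3 := by omega
    rw [harg]
    rfl
  · rintro rfl
    have h := FlattenedPattern.numAvoiding_succ 1
    norm_num [FlattenedPattern.extSum, FlattenedPattern.insSum_nil, FlattenedPattern.avoidInd,
      FlattenedPattern.occRec] at h
    exact_mod_cast h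
  · obtain ⟨m, rfl⟩ := Nat.exists_eq_add_of_le' (le_trans one_le_two hn)
    rw [FlattenedPattern.avgOcc_succ]
    push_cast
    rfl
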